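/- Let $M$ be a real-analytic $n$-manifold (Hausdorff, second countable), $G$ a compact Lie group, $P\to M$ a smooth principal $G$-bundle, $\mathcal A$ the space of smooth connections on $P$, and $\rho$ a unitary representation of $G$ of dimension $k\ge 1$. A loop is a continuous piecewise real-analytic map $\gamma\colon S^1\to M$: $S^1$ is a finite union of closed intervals, on each of which $\gamma$ extends to a real-analytic map on an open interval containing it. Let $T(\gamma)\colon\mathcal A\to\mathbb C$ be its Wilson loop, $T(\gamma)(A)=\frac1k\operatorname{tr}\rho(\operatorname{hol}_\gamma(A))$. An embedded graph is a nonempty set $\phi\subseteq M$ for which there are finitely many one-to-one real-analytic maps $\phi_i\colon[0,1]\to M$ (extending analytically to an open interval containing $[0,1]$) such that $\phi=\bigcup_i\phi_i[0,1]$, each $\phi_i|_{(0,1)}$ is an embedding, and $\phi_i[0,1]\cap\phi_j[0,1]\subseteq\{\phi_i(0),\phi_i(1)\}$ for all $i\neq j$. For an embedded graph $\phi$ let $\mathbf A_0(\phi)$ be the unital algebra of functions on $\mathcal A$ generated by the $T(\gamma)$ for all loops $\gamma$ with range in $\phi$ (it is closed under complex conjugation), and let $\mathbf A(\phi)$ be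 its closure in the norm $\|f\|_\infty=\sup_{A\in\mathcal A}|f(A)|$, a C*-algebra. If $\phi\subseteq\psi$, then $\mathbf A(\phi)\subseteq\mathbf A(\psi)$. For each embedded graph $\phi$ let $\int_\phi$ be a continuous linear functional on $\mathbf A(\phi)$. Suppose that the family $\{\int_\phi\}$ is consistent, that is, $\int_\phi$ is the restriction of $\int_\psi$ to $\mathbf A(\phi)$ whenever $\phi\subseteq\psi$, and that every $\int_\phi$ is positive, that is, $\int_\phi\overline f f\ge 0$ for all $f\in\mathbf A(\phi)$. Then the family is uniformly bounded: there is a constant $C>0$ with $\|\int_\phi\|\le C$ for all embedded graphs $\phi$. Moreover $\|\int_\phi\|=\int_\psi 1$ for any two embedded graphs $\phi,\psi$; that is, all the norms equal the common value of the functionals at the unit. -/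

import Mathlib

open Set Manifold
open scoped ContDiff ENNReal

noncomputable section

namespace HolonomyAlgebra

/-! ## Loops and embedded graphs in a real-analytic manifold -/

section Curves

variable (n : ℕ) (M : Type*) [TopologicalSpace M] [ChartedSpace (EuclideanSpace ℝ (Fin n)) M]

/-- The curve `c` (of which only the values on `[a, b]` matter) extends, from the closed interval
`[a, b]`, to a real-analytic curve in `M` on an open interval containing `[a, b]`. -/
def ExtendsAnalytically {n : ℕ} {M : Type*} [TopologicalSpace M]
    [ChartedSpace (EuclideanSpace ℝ (Fin n)) M] (c : ℝ → M) (a b : ℝ) : Prop :=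
  ∃ ε > 0, ∃ f : ℝ → M, ContMDiffOn 𝓘(ℝ, ℝ) (𝓡 n) ω f (Ioo (a - ε) (b + ε)) ∧
    EqOn f c (Icc a b)

/-- A loop: a continuous map `S¹ → M`, where `S¹ = ℝ/ℤ`, such that `S¹` is a finite union of closed
intervals on each of which the map extends to a real-analytic one on a larger open interval. -/
structure Loop where
  /-- the underlying map -/
  toFun : UnitAddCircle → M
  continuous_toFun : Continuous toFun
  piecewise_analytic : ∃ S : Finset (ℝ × ℝ), (∀ I ∈ S, I.1 ≤ I.2) ∧
    (⋃ I ∈ S, (fun t : ℝ => (t : UnitAddCircle)) '' Icc I.1 I.2) = univ ∧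
    ∀ I ∈ S, ExtendsAnalytically (n := n) (fun t : ℝ => toFun (t : UnitAddCircle)) I.1 I.2

/-- An edge: a one-to-one real-analytic map `[0,1] → M` (analytic up to and including the
end points, and represented by a function on `ℝ` of which only the values on `[0,1]` matter) whose
restriction to `(0,1)` is an embedding, that is, an immersion that is a homeomorphism onto
its image. -/
structure IsEdge (e : ℝ → M) : Prop where
  analytic : ExtendsAnalytically (n := n) e 0 1
  injOn : InjOn e (Icc 0 1)
  immersion : ∀ t ∈ Ioo (0 : ℝ) 1, Function.Injective (mfderiv 𝓘(ℝ, ℝ) (𝓡 n) e t)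
  isEmbedding : Topology.IsEmbedding ((Ioo (0 : ℝ) 1).domRestrict e)

/-- An embedded graph: a nonempty subset of `M` that is the union of finitely many edges, any two
different ones of which meet at most in common end points. -/
def IsEmbeddedGraph (φ : Set M) : Prop :=
  φ.Nonempty ∧ ∃ (N : ℕ) (e : Fin N → ℝ → M),
    (∀ i, IsEdge n M (e i)) ∧
    φ = ⋃ i, e i '' Icc 0 1 ∧
    ∀ i j, i ≠ j → e i '' Icc 0 1 ∩ e j '' Icc 0 1 ⊆ {e i 0, e i 1}

/-- The type of embedded graphs in `M`. An embedded graph is just a set. -/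
def EmbeddedGraph : Type _ := {φ : Set M // IsEmbeddedGraph n M φ}

variable {n M}

/-- The reversed curve of an analytically extendable curve is analytically extendable. -/
lemma ExtendsAnalytically.neg {c : ℝ → M} {a b : ℝ} (h : ExtendsAnalytically (n := n) c a b) :
    ExtendsAnalytically (n := n) (fun t => c (-t)) (-b) (-a) := by
  obtain ⟨ε, hε, f, hf, hfc⟩ := h
  refine ⟨ε, hε, fun t => f (-t), ?_, ?_⟩
  · refine hf.comp (t := Ioo (a - ε) (b + ε)) (contMDiff_iff_contDiff.2 contDiff_neg).contMDiffOn ?_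
    rintro t ⟨h1, h2⟩
    exact ⟨by linarith, by linarith⟩
  · rintro t ⟨h1, h2⟩
    exact hfc ⟨by linarith, by linarith⟩

/-- The loop with reversed orientation. -/
def Loop.rev (γ : Loop n M) : Loop n M where
  toFun s := γ.toFun (-s)
  continuous_toFun := γ.continuous_toFun.comp continuous_neg
  piecewise_analytic := by
    classical
    obtain ⟨S, h1, h2, h3⟩ := γ.piecewise_analytic
    refine ⟨S.image fun I => (-I.2, -I.1), ?_, ?_, ?_⟩
    · intro I hI
      obtain ⟨J, hJ, rfl⟩ := Finset.mem_image.1 hI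
      simpa using h1 J hJ
    · rw [eq_univ_iff_forall] at h2 ⊢
      intro s
      obtain ⟨J, hJ, t, ht, hts⟩ := mem_iUnion₂.1 (h2 (-s))
      refine mem_iUnion₂.2 ⟨(-J.2, -J.1), Finset.mem_image_of_mem _ hJ, -t, ?_, ?_⟩
      · exact ⟨neg_le_neg ht.2, neg_le_neg ht.1⟩
      · have hts' : ((t : ℝ) : UnitAddCircle) = -s := hts
        simp [hts']
    · intro I hI
      obtain ⟨J, hJ, rfl⟩ := Finset.mem_image.1 hI
      have := (h3 J hJ).neg
      simpa using this

end Curves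

/-! ## Principal bundles, connections and holonomy -/

section Bundles

variable (n m d : ℕ)
  (M : Type*) [TopologicalSpace M] [ChartedSpace (EuclideanSpace ℝ (Fin n)) M]
  (G : Type*) [TopologicalSpace G] [ChartedSpace (EuclideanSpace ℝ (Fin m)) G] [Group G]
  (P : Type*) [TopologicalSpace P] [ChartedSpace (EuclideanSpace ℝ (Fin d)) P]

/-- The structure of a smooth principal `G`-bundle `P → M`: a smooth projection, a smooth right
action of `G` on `P`, and near every point of `M` a smooth `G`-equivariant local trivialization. -/
structure PrincipalBundle where
  /-- the projection -/
  proj : P → M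
  /-- the right action of the structure group -/
  act : P → G → P
  contMDiff_proj : ContMDiff (𝓡 d) (𝓡 n) ∞ proj
  contMDiff_act : ContMDiff ((𝓡 d).prod (𝓡 m)) (𝓡 d) ∞ (fun x : P × G => act x.1 x.2)
  act_one : ∀ p, act p 1 = p
  act_mul : ∀ p g h, act p (g * h) = act (act p g) h
  exists_trivialization : ∀ x : M, ∃ e : Bundle.Trivialization G proj, x ∈ e.baseSet ∧
    ContMDiffOn (𝓡 d) ((𝓡 n).prod (𝓡 m)) ∞ e e.source ∧
    ContMDiffOn ((𝓡 n).prod (𝓡 m)) (𝓡 d) ∞ e.toOpenPartialHomeomorph.symm e.target ∧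
    ∀ p ∈ e.source, ∀ g : G, act p g ∈ e.source ∧ e (act p g) = ((e p).1, (e p).2 * g)

variable {n m d M G P}

/-- The adjoint action of `g` on the Lie algebra: the derivative at `1` of `h ↦ g h g⁻¹`. -/
def Ad (m : ℕ) {G : Type*} [TopologicalSpace G] [ChartedSpace (EuclideanSpace ℝ (Fin m)) G]
    [Group G] (g : G) : GroupLieAlgebra (𝓡 m) G →L[ℝ] GroupLieAlgebra (𝓡 m) G :=
  mfderiv (𝓡 m) (𝓡 m) (fun h : G => g * h * g⁻¹) 1

/-- A smooth connection on `P`: a smooth Lie-algebra-valued one-form on `P` that reproduces the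
generators of the fundamental vector fields and is equivariant. Smoothness is that of the form
as a function on the tangent bundle of `P`. -/
structure Connection [IsManifold (𝓡 d) ∞ P] (B : PrincipalBundle n m d M G P) where
  /-- the connection form -/
  form : ∀ p : P, TangentSpace (𝓡 d) p →L[ℝ] GroupLieAlgebra (𝓡 m) G
  smooth : ContMDiff (M' := EuclideanSpace ℝ (Fin m)) (𝓡 d).tangent (𝓡 m) ∞
    (fun v : TangentBundle (𝓡 d) P => form v.proj v.snd)
  reproduces : ∀ (p : P) (X : GroupLieAlgebra (𝓡 m) G),
    form (B.act p 1) (mfderiv (𝓡 m) (𝓡 d) (fun g : G => B.act p g) 1 X) = X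
  equivariant : ∀ (p : P) (g : G) (v : TangentSpace (𝓡 d) p),
    form (B.act p g) (mfderiv (𝓡 d) (𝓡 d) (fun q : P => B.act q g) p v) = Ad m g⁻¹ (form p v)

variable [IsManifold (𝓡 d) ∞ P] {B : PrincipalBundle n m d M G P}

/-- `c`, on `[0,1]`, is a horizontal lift of the loop `γ` for the connection `A`: it is continuous,
lies over `γ`, and except at finitely many times has a derivative, which is horizontal. -/
def IsHorizontalLift (A : Connection B) (γ : Loop n M) (c : ℝ → P) : Prop :=
  ContinuousOn c (Icc 0 1) ∧
  (∀ t ∈ Icc (0 : ℝ) 1, B.proj (c t) = γ.toFun (t : UnitAddCircle)) ∧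
  ∃ S : Finset ℝ, ∀ t ∈ Ioo (0 : ℝ) 1, t ∉ S →
    MDifferentiableAt 𝓘(ℝ, ℝ) (𝓡 d) c t ∧
    A.form (c t) (mfderiv 𝓘(ℝ, ℝ) (𝓡 d) c t (1 : ℝ)) = 0

/-- The normalized trace `τ = (1/k) tr ρ` of a unitary representation of dimension `k`. -/
def normTrace {k : ℕ} (ρ : G →ₜ* Matrix.unitaryGroup (Fin k) ℂ) (g : G) : ℂ :=
  (1 / (k : ℂ)) * Matrix.trace (ρ g : Matrix (Fin k) (Fin k) ℂ)

/-- `z` is the normalized trace `τ g` of a holonomy `g` of `A` around `γ`: some horizontal lift of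
`γ` starts at a point `p` and ends at `p g`. -/
def IsHolonomyTrace {k : ℕ} (ρ : G →ₜ* Matrix.unitaryGroup (Fin k) ℂ) (A : Connection B)
    (γ : Loop n M) (z : ℂ) : Prop :=
  ∃ (c : ℝ → P) (g : G), IsHorizontalLift A γ c ∧ c 1 = B.act (c 0) g ∧ z = normTrace ρ g

open Classical in
/-- The Wilson loop `T(γ, A)`: the normalized trace of the holonomy of `A` around `γ`, that is, the
unique `z` with `IsHolonomyTrace ρ A γ z`. (For a compact Lie group `G` a horizontal lift exists
from each point over `γ(0)` and is unique, and another starting point changes the holonomy by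
a conjugation, so there is exactly one such `z`; the alternative `0` never occurs.) -/
def wilson {k : ℕ} (ρ : G →ₜ* Matrix.unitaryGroup (Fin k) ℂ) (γ : Loop n M)
    (A : Connection B) : ℂ :=
  if h : ∃! z, IsHolonomyTrace ρ A γ z then h.choose else 0

lemma norm_normTrace_le {k : ℕ} (ρ : G →ₜ* Matrix.unitaryGroup (Fin k) ℂ) (g : G) :
    ‖normTrace ρ g‖ ≤ 1 := by
  rcases Nat.eq_zero_or_pos k with rfl | hk
  · simp [normTrace]
  have hk' : (0 : ℝ) < k := by exact_mod_cast hk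
  have h : ‖Matrix.trace (ρ g : Matrix (Fin k) (Fin k) ℂ)‖ ≤ k := by
    refine (norm_sum_le _ _).trans ?_
    refine (Finset.sum_le_sum fun i _ => entry_norm_bound_of_unitary (ρ g).2 i i).trans ?_
    simp
  rw [normTrace, norm_mul, norm_div, norm_one, Complex.norm_natCast, one_div,
    inv_mul_le_iff₀ hk', mul_one]
  exact h

lemma normTrace_inv {k : ℕ} (ρ : G →ₜ* Matrix.unitaryGroup (Fin k) ℂ) (g : G) :
    normTrace ρ g⁻¹ = star (normTrace ρ g) := by
  simp [normTrace, Matrix.star_eq_conjTranspose, Matrix.trace_conjTranspose]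

/-- Wilson loops are bounded by `1`. -/
lemma norm_wilson_le {k : ℕ} (ρ : G →ₜ* Matrix.unitaryGroup (Fin k) ℂ) (γ : Loop n M)
    (A : Connection B) : ‖wilson ρ γ A‖ ≤ 1 := by
  unfold wilson
  split_ifs with h
  · obtain ⟨c, g, -, -, hz⟩ := h.choose_spec.1
    rw [hz]
    exact norm_normTrace_le ρ g
  · simp

lemma IsHorizontalLift.rev {A : Connection B} {γ : Loop n M} {c : ℝ → P}
    (h : IsHorizontalLift A γ c) : IsHorizontalLift A γ.rev (fun t => c (1 - t)) := by
  classical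
  obtain ⟨h1, h2, S, h3⟩ := h
  refine ⟨?_, ?_, S.image fun t => 1 - t, ?_⟩
  · refine h1.comp (by fun_prop) ?_
    rintro t ⟨ht0, ht1⟩
    exact ⟨by linarith, by linarith⟩
  · rintro t ⟨ht0, ht1⟩
    rw [h2 (1 - t) ⟨by linarith, by linarith⟩]
    simp only [Loop.rev]
    congr 1
    have : ((1 : ℝ) : UnitAddCircle) = 0 := AddCircle.coe_period 1
    rw [AddCircle.coe_sub, this, zero_sub]
  · rintro t ⟨ht0, ht1⟩ htS
    have htS' : 1 - t ∉ S := fun hS =>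
      htS (Finset.mem_image.2 ⟨1 - t, hS, by ring⟩)
    obtain ⟨h4, h5⟩ := h3 (1 - t) ⟨by linarith, by linarith⟩ htS'
    have hr : HasMFDerivAt 𝓘(ℝ, ℝ) 𝓘(ℝ, ℝ) (fun t : ℝ => 1 - t) t
        (-ContinuousLinearMap.id ℝ ℝ) := by
      have : HasFDerivAt (fun t : ℝ => 1 - t) (-ContinuousLinearMap.id ℝ ℝ) t :=
        (hasFDerivAt_id t).const_sub 1
      exact this.hasMFDerivAt
    have h6 := HasMFDerivAt.comp t (h4.hasMFDerivAt) hr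
    refine ⟨h6.mdifferentiableAt, ?_⟩
    have h7 := h6.mfderiv
    have h8 : mfderiv 𝓘(ℝ, ℝ) (𝓡 d) (fun t => c (1 - t)) t (1 : ℝ) =
        -(mfderiv 𝓘(ℝ, ℝ) (𝓡 d) c (1 - t) (1 : ℝ)) := by
      have h9 := congrArg (fun L : ℝ →L[ℝ] EuclideanSpace ℝ (Fin d) => L 1) h7
      refine h9.trans ?_
      exact (mfderiv 𝓘(ℝ, ℝ) (𝓡 d) c (1 - t)).map_neg (1 : ℝ)
    rw [h8, map_neg, h5, neg_zero]

lemma Loop.rev_rev (γ : Loop n M) : γ.rev.rev = γ := by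
  cases γ
  simp [Loop.rev]

lemma IsHolonomyTrace.rev {k : ℕ} {ρ : G →ₜ* Matrix.unitaryGroup (Fin k) ℂ} {A : Connection B}
    {γ : Loop n M} {z : ℂ} (h : IsHolonomyTrace ρ A γ z) :
    IsHolonomyTrace ρ A γ.rev (star z) := by
  obtain ⟨c, g, hc, hg, rfl⟩ := h
  refine ⟨fun t => c (1 - t), g⁻¹, hc.rev, ?_, (normTrace_inv ρ g).symm⟩
  simp only [sub_self, sub_zero, hg]
  rw [← B.act_mul, mul_inv_cancel, B.act_one]

/-- The complex conjugate of `T(γ)` is `T(γ⁻¹)`. -/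
lemma wilson_rev {k : ℕ} (ρ : G →ₜ* Matrix.unitaryGroup (Fin k) ℂ) (γ : Loop n M)
    (A : Connection B) : wilson ρ γ.rev A = star (wilson ρ γ A) := by
  have key : ∀ {δ : Loop n M}, (∃! z, IsHolonomyTrace ρ A δ z) →
      ∃! z, IsHolonomyTrace ρ A δ.rev z := by
    rintro δ ⟨z, hz, hu⟩
    refine ⟨star z, hz.rev, fun w hw => ?_⟩
    have := hw.rev
    rw [Loop.rev_rev] at this
    rw [← hu _ this, star_star]
  by_cases h : ∃! z, IsHolonomyTrace ρ A γ z
  · have h' := key h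
    unfold wilson
    rw [dif_pos h, dif_pos h']
    exact h'.unique h'.choose_spec.1 h.choose_spec.1.rev
  · have h' : ¬ ∃! z, IsHolonomyTrace ρ A γ.rev z := fun h' => h (by
      have := key h'
      rwa [Loop.rev_rev] at this)
    unfold wilson
    rw [dif_neg h, dif_neg h', star_zero]

/-! ## The algebras `A(φ)` -/

/-- Bounded complex functions on the space of connections, with the sup norm; a commutative
C*-algebra with pointwise operations. -/
def BddFun (B : PrincipalBundle n m d M G P) : Type _ := lp (fun _ : Connection B => ℂ) ∞

instance (B : PrincipalBundle n m d M G P) : CommCStarAlgebra (BddFun B) :=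
  inferInstanceAs (CommCStarAlgebra (lp (fun _ : Connection B => ℂ) ∞))

/-- The Wilson loop `T(γ)` as a bounded function on the space of connections. -/
def T {k : ℕ} (ρ : G →ₜ* Matrix.unitaryGroup (Fin k) ℂ) (B : PrincipalBundle n m d M G P)
    (γ : Loop n M) : BddFun B :=
  ⟨fun A => wilson ρ γ A, memℓp_infty ⟨1, by
    rintro _ ⟨A, rfl⟩
    exact norm_wilson_le ρ γ A⟩⟩

lemma star_T {k : ℕ} (ρ : G →ₜ* Matrix.unitaryGroup (Fin k) ℂ) (B : PrincipalBundle n m d M G P)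
    (γ : Loop n M) : star (T ρ B γ) = T ρ B γ.rev := by
  refine lp.ext (funext fun A => ?_)
  exact (wilson_rev ρ γ A).symm

/-- The Wilson loops of the loops with range in the set `φ`. -/
def wilsonSet {k : ℕ} (ρ : G →ₜ* Matrix.unitaryGroup (Fin k) ℂ)
    (B : PrincipalBundle n m d M G P) (φ : Set M) : Set (BddFun B) :=
  {f | ∃ γ : Loop n M, range γ.toFun ⊆ φ ∧ f = T ρ B γ}

lemma star_wilsonSet {k : ℕ} (ρ : G →ₜ* Matrix.unitaryGroup (Fin k) ℂ)
    (B : PrincipalBundle n m d M G P) (φ : Set M) :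
    star (wilsonSet ρ B φ) ⊆ wilsonSet ρ B φ := by
  rintro f ⟨γ, hγ, hf⟩
  refine ⟨γ.rev, ?_, ?_⟩
  · rintro _ ⟨s, rfl⟩
    exact hγ ⟨-s, rfl⟩
  · rw [← star_T, ← hf, star_star]

/-- The algebra `A₀(φ)` generated by the Wilson loops `T(γ)` of all loops `γ` with range in `φ`;
it is closed under complex conjugation. -/
def algebraZero {k : ℕ} (ρ : G →ₜ* Matrix.unitaryGroup (Fin k) ℂ)
    (B : PrincipalBundle n m d M G P) (φ : EmbeddedGraph n M) : StarSubalgebra ℂ (BddFun B) where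
  toSubalgebra := Algebra.adjoin ℂ (wilsonSet ρ B φ.1)
  star_mem' := by
    intro f hf
    have h := Subalgebra.star_mem_star_iff (Algebra.adjoin ℂ (wilsonSet ρ B φ.1)) f |>.2 hf
    rw [Subalgebra.star_adjoin_comm] at h
    exact Algebra.adjoin_mono (star_wilsonSet ρ B φ.1) h

/-- The C*-algebra `A(φ)`: the closure of `A₀(φ)` in the sup norm. -/
def algebra {k : ℕ} (ρ : G →ₜ* Matrix.unitaryGroup (Fin k) ℂ)
    (B : PrincipalBundle n m d M G P) (φ : EmbeddedGraph n M) : StarSubalgebra ℂ (BddFun B) :=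
  (algebraZero ρ B φ).topologicalClosure

/-- If `φ ⊆ ψ` then `A(φ) ⊆ A(ψ)`. -/
lemma algebra_mono {k : ℕ} (ρ : G →ₜ* Matrix.unitaryGroup (Fin k) ℂ)
    (B : PrincipalBundle n m d M G P) {φ ψ : EmbeddedGraph n M} (h : φ.1 ⊆ ψ.1) :
    algebra ρ B φ ≤ algebra ρ B ψ := by
  apply StarSubalgebra.topologicalClosure_mono
  exact Algebra.adjoin_mono (R := ℂ) fun f ⟨γ, hγ, hf⟩ => ⟨γ, hγ.trans h, hf⟩

/-! ## Families of functionals -/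

/-- A family of functionals: for each embedded graph `φ` an element of the dual `A(φ)*`. -/
abbrev FunctionalFamily {k : ℕ} (ρ : G →ₜ* Matrix.unitaryGroup (Fin k) ℂ)
    (B : PrincipalBundle n m d M G P) : Type _ :=
  ∀ φ : EmbeddedGraph n M, algebra ρ B φ →L[ℂ] ℂ

variable {k : ℕ} {ρ : G →ₜ* Matrix.unitaryGroup (Fin k) ℂ}

/-- The family is consistent: whenever `φ ⊆ ψ`, the functional of `φ` is the restriction to `A(φ)`
of the functional of `ψ`. -/
def Consistent (I : FunctionalFamily ρ B) : Prop :=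
  ∀ (φ ψ : EmbeddedGraph n M) (h : φ.1 ⊆ ψ.1) (f : algebra ρ B φ),
    I φ f = I ψ (StarSubalgebra.inclusion (algebra_mono ρ B h) f)

/-- Each functional of the family is positive: its value at every `f̄ f` is a nonnegative real. -/
def Positive (I : FunctionalFamily ρ B) : Prop :=
  ∀ (φ : EmbeddedGraph n M) (f : algebra ρ B φ),
    0 ≤ (I φ (star f * f)).re ∧ (I φ (star f * f)).im = 0

/-- The family is uniformly bounded. -/
def UniformlyBounded (I : FunctionalFamily ρ B) : Prop :=
  ∃ C : ℝ, 0 < C ∧ ∀ φ : EmbeddedGraph n M, ‖I φ‖ ≤ C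

end Bundles

end HolonomyAlgebra

end

/-! A positive functional on a unital C*-algebra attains its norm at the unit, by Cauchy–Schwarz for
the form `f (star a * b)`; this is `CStarAlgebra.norm_eq_apply_one_of_positive`. So it suffices that
all the functionals agree at the unit.

Consistency gives this for nested graphs, because the inclusion of algebras is unital. Two arbitrary
graphs `φ`, `ψ` are linked by a zigzag φ ⊇ φ' ⊆ χ ⊇ ψ' ⊆ ψ, where φ' and ψ' are short disjoint arcs
and χ is their union (`EmbeddedGraph.exists_subgraphs_union`). Passing to small arcs avoids
analysing how two analytic graphs intersect: no graph containing both `φ` and `ψ` is needed. -/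

namespace CStarAlgebra

/-! ### Positive functionals on unital C*-algebras -/

open scoped ComplexOrder in
/-- The norm of a positive linear functional on a unital C*-algebra is its value at the unit. -/
theorem norm_eq_apply_one_of_positive {A : Type*} [CStarAlgebra A] (f : A →L[ℂ] ℂ)
    (hf : ∀ a, 0 ≤ f (star a * a)) : ((‖f‖ : ℝ) : ℂ) = f 1 := by
  -- In the spectral order the nonnegative elements are exactly the `star b * b`, so `hf` says that
  -- `f` is monotone and the GNS form is available.
  let _ : PartialOrder A := spectralOrder A
  have _ : StarOrderedRing A := spectralOrderedRing A
  let F : A →ₚ[ℂ] ℂ := PositiveLinearMap.mk₀ f.toLinearMap fun a ha => by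
    obtain ⟨b, rfl⟩ := nonneg_iff_eq_star_mul_self.1 ha
    exact hf b
  have hF : ∀ a, F a = f a := fun _ => rfl
  have h1 : 0 ≤ f 1 := by simpa using hf 1
  have hre : ((‖f 1‖ : ℝ) : ℂ) = f 1 := Complex.eq_coe_norm_of_nonneg h1 |>.symm
  have hone : ‖F.toPreGNS 1‖ ^ 2 = ‖f 1‖ := by
    have := F.preGNS_norm_sq (F.toPreGNS 1)
    rw [F.ofPreGNS_toPreGNS, star_one, one_mul, hF, ← hre] at this
    exact_mod_cast this
  -- The GNS seminorm satisfies ‖a‖² = f(a*a), which is at most |f(1)| ‖a*a‖; the C*-identity turns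
  -- the last factor into ‖a‖².
  have hsq : ∀ a, ‖F.toPreGNS a‖ ^ 2 ≤ ‖f 1‖ * ‖a‖ ^ 2 := fun a => by
    have h := F.preGNS_norm_sq (F.toPreGNS a)
    rw [F.ofPreGNS_toPreGNS] at h
    have h' := F.norm_apply_le_of_nonneg _ (star_mul_self_nonneg a)
    rw [← h, CStarRing.norm_star_mul_self, ← sq, hF] at h'
    simpa using h'
  have hle : ‖f‖ ≤ ‖f 1‖ := f.opNorm_le_bound (norm_nonneg _) fun a => by
    -- Cauchy–Schwarz for 1 and a: |f(a)|² ≤ f(1) f(a*a) ≤ |f(1)|² ‖a‖².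
    have h := norm_inner_le_norm (𝕜 := ℂ) (F.toPreGNS 1) (F.toPreGNS a)
    rw [F.preGNS_inner_def, F.ofPreGNS_toPreGNS, F.ofPreGNS_toPreGNS, star_one, one_mul, hF] at h
    refine h.trans (abs_le_of_sq_le_sq' ?_ (by positivity)).2
    rw [mul_pow, hone, mul_pow, sq ‖f 1‖, mul_assoc]
    exact mul_le_mul_of_nonneg_left (hsq a) (norm_nonneg _)
  have hge : ‖f 1‖ ≤ ‖f‖ := by
    -- In the zero algebra the unit has norm 0, so `‖1‖ = 1` cannot be used there.
    rcases subsingleton_or_nontrivial A with _ | _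
    · rw [Subsingleton.elim (1 : A) 0, map_zero, norm_zero]
      exact norm_nonneg _
    · simpa using f.le_opNorm 1
  rw [hle.antisymm hge, hre]

end CStarAlgebra

namespace HolonomyAlgebra

/-! ### Subarcs of edges and small subgraphs -/

section Graphs

variable {n : ℕ} {M : Type*} [TopologicalSpace M] [ChartedSpace (EuclideanSpace ℝ (Fin n)) M]

/-- A nondegenerate subarc of an edge, reparametrized by `[0, 1]`, is an edge. -/
lemma IsEdge.subarc {e : ℝ → M} (he : IsEdge n M e) {a b : ℝ} (ha : 0 ≤ a) (hab : a < b)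
    (hb : b ≤ 1) : IsEdge n M (fun t => e ((b - a) * t + a)) := by
  have hpos : 0 < b - a := sub_pos.2 hab
  have hIcc : MapsTo (fun t => (b - a) * t + a) (Icc 0 1) (Icc 0 1) := by
    rintro t ⟨h0, h1⟩
    exact ⟨by positivity, by nlinarith⟩
  have hIoo : MapsTo (fun t => (b - a) * t + a) (Ioo 0 1) (Ioo 0 1) := by
    rintro t ⟨h0, h1⟩
    exact ⟨by positivity, by nlinarith⟩
  refine ⟨?_, ?_, fun t ht => ?_, ?_⟩
  · obtain ⟨ε, hε, f, hf, hfe⟩ := he.analytic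
    -- The same `ε` works because the affine map has slope `b - a ≤ 1` and sends `[0, 1]` into
    -- itself.
    refine ⟨ε, hε, fun t => f ((b - a) * t + a), ?_, fun t ht => hfe (hIcc ht)⟩
    have haff : ContMDiff 𝓘(ℝ, ℝ) 𝓘(ℝ, ℝ) ω (fun t : ℝ => (b - a) * t + a) :=
      contMDiff_iff_contDiff.2 (by fun_prop)
    refine hf.comp haff.contMDiffOn ?_
    rintro t ⟨h0, h1⟩
    exact ⟨by nlinarith, by nlinarith⟩
  · intro s hs t ht hst
    have := he.injOn (hIcc hs) (hIcc ht) hst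
    exact mul_left_cancel₀ hpos.ne' (add_right_cancel this)
  · have hinj := he.immersion _ (hIoo ht)
    have hd : MDifferentiableAt 𝓘(ℝ, ℝ) (𝓡 n) e ((b - a) * t + a) := by
      -- `mfderiv` is 0 by default where `e` is not differentiable, and 0 is not injective on ℝ; so
      -- the immersion condition already forces differentiability.
      by_contra h
      rw [mfderiv_zero_of_not_mdifferentiableAt h] at hinj
      exact one_ne_zero (α := ℝ) (hinj (a₁ := (1 : ℝ)) (a₂ := (0 : ℝ)) rfl)
    have haff : HasMFDerivAt 𝓘(ℝ, ℝ) 𝓘(ℝ, ℝ) (fun t : ℝ => (b - a) * t + a) t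
        ((b - a) • ContinuousLinearMap.id ℝ ℝ) :=
      (((hasFDerivAt_id t).const_mul (b - a)).add_const a).hasMFDerivAt
    have hcomp : mfderiv 𝓘(ℝ, ℝ) (𝓡 n) (fun t => e ((b - a) * t + a)) t = _ :=
      (HasMFDerivAt.comp t hd.hasMFDerivAt haff).mfderiv
    rw [hcomp]
    exact hinj.comp (smul_right_injective ℝ hpos.ne')
  · have hg : Topology.IsEmbedding hIoo.restrict := by
      refine .of_comp (Continuous.restrict hIoo (by fun_prop)) continuous_subtype_val ?_
      exact (affineHomeomorph (b - a) a hpos.ne').isEmbedding.comp .subtypeVal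
    exact he.isEmbedding.comp hg

/-- Arbitrarily close to an interior point of an edge there is an edge contained in it. -/
lemma IsEdge.exists_subarc_subset {e : ℝ → M} (he : IsEdge n M e) {s : ℝ} (hs : s ∈ Ioo (0 : ℝ) 1)
    {U : Set M} (hU : U ∈ nhds (e s)) :
    ∃ e' : ℝ → M, IsEdge n M e' ∧ e' '' Icc 0 1 ⊆ e '' Icc 0 1 ∧ e' '' Icc 0 1 ⊆ U := by
  have hc : ContinuousAt e s :=
    (continuousOn_iff_continuous_domRestrict.2 he.isEmbedding.continuous).continuousAt
      (isOpen_Ioo.mem_nhds hs)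
  -- The arc over `[s - δ, s + δ]` will be the required edge: this interval lies in (0,1) and is
  -- mapped into `U`.
  obtain ⟨δ, hδ, hball⟩ := Metric.nhds_basis_closedBall.mem_iff.1
    (Filter.inter_mem (hc hU) (isOpen_Ioo.mem_nhds hs))
  rw [Real.closedBall_eq_Icc] at hball
  have h0 := (hball (left_mem_Icc.2 (by linarith))).2.1
  have h1 := (hball (right_mem_Icc.2 (by linarith))).2.2
  have hmem : ∀ t ∈ Icc (0 : ℝ) 1, (s + δ - (s - δ)) * t + (s - δ) ∈ Icc (s - δ) (s + δ) := by
    rintro t ⟨ht0, ht1⟩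
    exact ⟨by nlinarith, by nlinarith⟩
  refine ⟨_, he.subarc h0.le (by linarith) h1.le, ?_, ?_⟩
  · rintro _ ⟨t, ht, rfl⟩
    exact mem_image_of_mem e (Ioo_subset_Icc_self (hball (hmem t ht)).2)
  · rintro _ ⟨t, ht, rfl⟩
    exact (hball (hmem t ht)).1

/-- Finitely many disjoint edges form an embedded graph. -/
lemma isEmbeddedGraph_iUnion {N : ℕ} [NeZero N] {e : Fin N → ℝ → M} (he : ∀ i, IsEdge n M (e i))
    (hd : Pairwise fun i j => Disjoint (e i '' Icc 0 1) (e j '' Icc 0 1)) :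
    IsEmbeddedGraph n M (⋃ i, e i '' Icc 0 1) := by
  refine ⟨⟨e 0 0, mem_iUnion.2 ⟨0, mem_image_of_mem _ (by simp)⟩⟩, N, e, he, rfl, ?_⟩
  intro i j hij
  rw [(hd hij).inter_eq]
  exact empty_subset _

lemma IsEdge.isEmbeddedGraph {e : ℝ → M} (he : IsEdge n M e) :
    IsEmbeddedGraph n M (e '' Icc 0 1) := by
  have h := isEmbeddedGraph_iUnion (N := 1) (e := fun _ => e) (fun _ => he)
    fun i j hij => (hij (Subsingleton.elim i j)).elim
  rwa [iUnion_const] at h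

lemma IsEdge.isEmbeddedGraph_union {e e' : ℝ → M} (he : IsEdge n M e) (he' : IsEdge n M e')
    (hd : Disjoint (e '' Icc 0 1) (e' '' Icc 0 1)) :
    IsEmbeddedGraph n M (e '' Icc 0 1 ∪ e' '' Icc 0 1) := by
  have h := isEmbeddedGraph_iUnion (N := 2) (n := n) (e := ![e, e'])
    (by simp [Fin.forall_fin_two, he, he'])
    (by
      intro i j hij
      fin_cases i <;> fin_cases j <;> simp_all [disjoint_comm])
  have hU : ⋃ i, (![e, e'] : Fin 2 → ℝ → M) i '' Icc 0 1 = e '' Icc 0 1 ∪ e' '' Icc 0 1 := by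
    ext x
    simp [Fin.exists_fin_two]
  rwa [hU] at h

/-- Nonemptiness of the graph rules out an empty family of edges. -/
lemma IsEmbeddedGraph.exists_isEdge {φ : Set M} (hφ : IsEmbeddedGraph n M φ) :
    ∃ e : ℝ → M, IsEdge n M e ∧ e '' Icc 0 1 ⊆ φ := by
  obtain ⟨⟨x, hx⟩, N, e, he, rfl, -⟩ := hφ
  obtain ⟨i, -⟩ := mem_iUnion.1 hx
  exact ⟨e i, he i, subset_iUnion (fun i => e i '' Icc 0 1) i⟩

/-- Any two embedded graphs contain smaller ones, the union of which is an embedded graph. -/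
lemma EmbeddedGraph.exists_subgraphs_union [T2Space M] (φ ψ : EmbeddedGraph n M) :
    ∃ φ' ψ' χ : EmbeddedGraph n M, φ'.1 ⊆ φ.1 ∧ ψ'.1 ⊆ ψ.1 ∧ φ'.1 ⊆ χ.1 ∧ ψ'.1 ⊆ χ.1 := by
  obtain ⟨e, he, heφ⟩ := φ.2.exists_isEdge
  obtain ⟨e', he', heψ⟩ := ψ.2.exists_isEdge
  have hs : (1 / 2 : ℝ) ∈ Ioo (0 : ℝ) 1 := by norm_num
  -- The two edges may overlap or coincide. As `e'` is injective, its values at 1/2 and 1/3 cannot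
  -- both equal `e (1 / 2)`.
  obtain ⟨t, ht, hne⟩ : ∃ t ∈ Ioo (0 : ℝ) 1, e (1 / 2) ≠ e' t := by
    by_contra! h
    have h3 : (1 / 3 : ℝ) ∈ Ioo (0 : ℝ) 1 := by norm_num
    have := he'.injOn (Ioo_subset_Icc_self hs) (Ioo_subset_Icc_self h3)
      ((h _ hs).symm.trans (h _ h3))
    norm_num at this
  obtain ⟨U, V, hU, hV, heU, heV, hUV⟩ := t2_separation hne
  obtain ⟨e₁, he₁, he₁e, he₁U⟩ := he.exists_subarc_subset hs (hU.mem_nhds heU)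
  obtain ⟨e₂, he₂, he₂e, he₂V⟩ := he'.exists_subarc_subset ht (hV.mem_nhds heV)
  exact ⟨⟨_, he₁.isEmbeddedGraph⟩, ⟨_, he₂.isEmbeddedGraph⟩,
    ⟨_, he₁.isEmbeddedGraph_union he₂ (hUV.mono he₁U he₂V)⟩,
    he₁e.trans heφ, he₂e.trans heψ, subset_union_left, subset_union_right⟩

end Graphs

/-! ### Values of the functionals at the unit -/

section Functionals

variable {n m d k : ℕ}
  {M : Type*} [TopologicalSpace M] [ChartedSpace (EuclideanSpace ℝ (Fin n)) M]
  {G : Type*} [TopologicalSpace G] [ChartedSpace (EuclideanSpace ℝ (Fin m)) G] [Group G]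
  {P : Type*} [TopologicalSpace P] [ChartedSpace (EuclideanSpace ℝ (Fin d)) P]
  [IsManifold (𝓡 d) ∞ P] {B : PrincipalBundle n m d M G P}
  {ρ : G →ₜ* Matrix.unitaryGroup (Fin k) ℂ} {I : FunctionalFamily ρ B}

lemma Consistent.apply_one_of_subset (hI : Consistent I) {φ ψ : EmbeddedGraph n M}
    (h : φ.1 ⊆ ψ.1) : I φ 1 = I ψ 1 := by
  rw [hI φ ψ h 1, map_one]

/-- The functionals of a consistent family all have the same value at the unit. -/
lemma Consistent.apply_one_eq [T2Space M] (hI : Consistent I) (φ ψ : EmbeddedGraph n M) :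
    I φ 1 = I ψ 1 := by
  obtain ⟨φ', ψ', χ, hφ, hψ, hφχ, hψχ⟩ := φ.exists_subgraphs_union ψ
  rw [← hI.apply_one_of_subset hφ, ← hI.apply_one_of_subset hψ, hI.apply_one_of_subset hφχ,
    hI.apply_one_of_subset hψχ]

open scoped ComplexOrder in
lemma Positive.norm_eq_apply_one (hI : Positive I) (φ : EmbeddedGraph n M) :
    ((‖I φ‖ : ℝ) : ℂ) = I φ 1 := by
  -- Closedness makes the subalgebra complete, hence a C*-algebra in its own right.
  have : IsClosed (algebra ρ B φ : Set (BddFun B)) :=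
    StarSubalgebra.isClosed_topologicalClosure _
  exact CStarAlgebra.norm_eq_apply_one_of_positive (I φ) fun f =>
    Complex.nonneg_iff.2 ⟨(hI φ f).1, (hI φ f).2.symm⟩

end Functionals

end HolonomyAlgebra

open HolonomyAlgebra in
theorem proposition2 {n m d k : ℕ} [NeZero k]
    {M : Type*} [TopologicalSpace M] [ChartedSpace (EuclideanSpace ℝ (Fin n)) M]
    [IsManifold (𝓡 n) ω M] [T2Space M] [SecondCountableTopology M]
    {G : Type*} [TopologicalSpace G] [ChartedSpace (EuclideanSpace ℝ (Fin m)) G] [Group G]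
    [LieGroup (𝓡 m) ∞ G] [T2Space G] [CompactSpace G]
    {P : Type*} [TopologicalSpace P] [ChartedSpace (EuclideanSpace ℝ (Fin d)) P]
    [IsManifold (𝓡 d) ∞ P]
    (B : PrincipalBundle n m d M G P) (ρ : G →ₜ* Matrix.unitaryGroup (Fin k) ℂ)
    (I : FunctionalFamily ρ B) (hcons : Consistent I) (hpos : Positive I) :
    UniformlyBounded I ∧
      ∀ φ ψ : EmbeddedGraph n M, ((‖I φ‖ : ℝ) : ℂ) = I ψ 1 := by
  have h : ∀ φ ψ : EmbeddedGraph n M, ((‖I φ‖ : ℝ) : ℂ) = I ψ 1 := fun φ ψ =>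
    (hpos.norm_eq_apply_one φ).trans (hcons.apply_one_eq φ ψ)
  refine ⟨?_, h⟩
  -- There may be no embedded graph at all, for instance if `n = 0`. Otherwise one norm bounds all;
  -- the added 1 keeps the constant positive when the functionals vanish.
  rcases isEmpty_or_nonempty (EmbeddedGraph n M) with _ | ⟨⟨φ⟩⟩
  · exact ⟨1, one_pos, isEmptyElim⟩
  · refine ⟨‖I φ‖ + 1, by positivity, fun ψ => ?_⟩
    have : ‖I ψ‖ = ‖I φ‖ := by exact_mod_cast (h ψ φ).trans (h φ φ).symm
    linarith
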